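/- Let $V$ and $W$ be finite-dimensional real vector spaces, let $\Gamma=(\gamma_1,\dots,\gamma_m)$ be vectors in $V^*$ and $\mathrm A=(\mathbf a_1,\dots,\mathbf a_m)$ vectors in $W^*$, and suppose that $\Gamma$ and $\mathrm A$ are Gale dual: the sequence $$0\to V\xrightarrow{\ \mathbf v\mapsto(\langle\gamma_1,\mathbf v\rangle,\dots,\langle\gamma_m,\mathbf v\rangle)\ }\mathbb R^m\xrightarrow{\ \mathbf e_i\mapsto\mathbf a_i\ }W^*\to0$$ is exact. Let $\mathcal K$ be a simplicial complex on $[m]=\{1,\dots,m\}$, that is, a family of subsets of $[m]$ that contains $\varnothing$ and is closed under taking subsets (one-element sets need not belong to it). Assume that $\{\mathcal K,\mathrm A\}$ is a triangulated configuration defining a complete simplicial fan: the vectors $\mathbf a_i$, $i\in I$, are linearly independent for each $I\in\mathcal K$, the cones $\operatorname{cone}(\mathbf a_i: i\in I)$, $I\in\mathcal K$, form a fan in $W^*$ in which the cones of $I$ and $J$ intersect in the cone of $I\cap J$, and these cones cover $W^*$. Assume that $\dim V=2\ell$, let $\mathcal J\colon V\to V$ be a complex structure ($\mathcal J^2=-\mathrm{id}$),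 let $\widetilde V=(V,\mathcal J)$, and put $\langle\gamma,\mathbf v\rangle_{\mathbb C}=\langle\gamma,\mathbf v\rangle-i\langle\gamma,\mathcal J\mathbf v\rangle$. Let $\widetilde V$ act on $$U_{\mathbb C}(\mathcal K)=\mathbb C^m\setminus\bigcup_{I\subset[m],\,I\notin\mathcal K}\{\mathbf z: z_i=0\text{ for all }i\in I\}$$ by the holomorphic exponential action $\mathbf v\cdot\mathbf z=(e^{\langle\gamma_1,\mathbf v\rangle_{\mathbb C}}z_1,\dots,e^{\langle\gamma_m,\mathbf v\rangle_{\mathbb C}}z_m)$. Let $$\mathcal Z_{\mathcal K}=(D^2,S^1)^{\mathcal K}=\bigcup_{I\in\mathcal K}\{\mathbf z\in\mathbb C^m: |z_i|\le1\text{ for all }i,\ |z_i|=1\text{ for }i\notin I\}.$$ Then there is a homeomorphism $U_{\mathbb C}(\mathcal K)/\widetilde V\cong\mathcal Z_{\mathcal K}$. Through this homeomorphism $\mathcal Z_{\mathcal K}$ acquires the structure of a compact complex manifold, of complex dimension $\dim W+\ell=m-\ell$, for which the resulting projection $U_{\mathbb C}(\mathcal K)\to\mathcal Z_{\mathcal K}$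 is a holomorphic submersion. -/

import Mathlib

open scoped Manifold ContDiff

noncomputable section

namespace MomentAngle

/-- A simplicial complex on `[m]`: a family of subsets of `[m]` that contains the empty set and is
closed under taking subsets.  Ghost vertices (indices `i` with `{i}` not in the family) are
allowed. -/
structure SimplicialComplexOn (m : ℕ) where
  faces : Set (Finset (Fin m))
  empty_mem : ∅ ∈ faces
  down_closed : ∀ ⦃I J : Finset (Fin m)⦄, I ∈ faces → J ⊆ I → J ∈ faces

instance (m : ℕ) : Membership (Finset (Fin m)) (SimplicialComplexOn m) :=
  ⟨fun K I => I ∈ K.faces⟩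

section Fans

variable {E : Type*} [AddCommGroup E] [Module ℝ E]

/-- A fan: a finite set of strongly convex polyhedral cones, closed under taking faces, such that
any two of its cones meet in a common face. -/
structure IsFan (S : Set (PointedCone ℝ E)) : Prop where
  finite : S.Finite
  polyhedral : ∀ σ ∈ S, ∃ s : Finset E, σ = PointedCone.hull ℝ (s : Set E)
  stronglyConvex : ∀ σ ∈ S, σ.toConvexCone.Salient
  face_mem : ∀ σ ∈ S, ∀ τ : PointedCone ℝ E, τ.IsFaceOf σ → τ ∈ S
  inter_left : ∀ σ ∈ S, ∀ τ ∈ S, (σ ⊓ τ).IsFaceOf σ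
  inter_right : ∀ σ ∈ S, ∀ τ ∈ S, (σ ⊓ τ).IsFaceOf τ

/-- A set of cones is complete if the cones cover the whole space. -/
def IsCompleteFan (S : Set (PointedCone ℝ E)) : Prop :=
  ⋃ σ ∈ S, (σ : Set E) = Set.univ

/-- The cone generated by the vectors `a i`, `i ∈ I`. -/
def coneOf {m : ℕ} (a : Fin m → E) (I : Finset (Fin m)) : PointedCone ℝ E :=
  PointedCone.hull ℝ (a '' (I : Set (Fin m)))

/-- The set of cones `cone (a i : i ∈ I)` for `I ∈ K`. -/
def cones {m : ℕ} (K : SimplicialComplexOn m) (a : Fin m → E) : Set (PointedCone ℝ E) :=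
  {σ | ∃ I ∈ K, σ = coneOf a I}

/-- `(K, a)` is a triangulated configuration (simplicial fan data): `a` spans, the cones over the
simplices of `K` form a fan, each is generated by a linearly independent family, and two of them
meet in the cone over the intersection of the two simplices. -/
structure IsTriangulatedConfiguration {m : ℕ} (K : SimplicialComplexOn m) (a : Fin m → E) :
    Prop where
  span_eq_top : Submodule.span ℝ (Set.range a) = ⊤
  isFan : IsFan (cones K a)
  linearIndepOn : ∀ I ∈ K, LinearIndepOn ℝ a (I : Set (Fin m))
  inter_eq : ∀ I ∈ K, ∀ J ∈ K, coneOf a I ⊓ coneOf a J = coneOf a (I ∩ J)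

end Fans

section Gale

variable {V W : Type*} [AddCommGroup V] [Module ℝ V] [AddCommGroup W] [Module ℝ W] {m : ℕ}

/-- Gale duality of the configurations `γ` in `V*` and `a` in `W*`: the sequence
`0 → V → ℝᵐ → W* → 0` is exact, where the first map is `v ↦ (⟨γ 1, v⟩, …, ⟨γ m, v⟩)` and the
second one sends the `i`-th standard basis vector to `a i`. -/
structure IsGaleDual (γ : Fin m → Module.Dual ℝ V) (a : Fin m → Module.Dual ℝ W) : Prop where
  injective : Function.Injective (LinearMap.pi γ)
  exact : Function.Exact (LinearMap.pi γ) (Fintype.linearCombination ℝ a)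
  surjective : Function.Surjective (Fintype.linearCombination ℝ a)

/-- The complex pairing `⟨γ, v⟩_ℂ = ⟨γ, v⟩ - i ⟨γ, J v⟩`. -/
def complexPairing (J : V →ₗ[ℝ] V) (γ : Module.Dual ℝ V) (v : V) : ℂ :=
  (γ v : ℂ) - Complex.I * (γ (J v) : ℂ)

/-- The map `(v, z) ↦ (exp ⟨γ 1, v⟩_ℂ * z 1, …, exp ⟨γ m, v⟩_ℂ * z m)`. -/
def expMap (γ : Fin m → Module.Dual ℝ V) (J : V →ₗ[ℝ] V) (v : V) (z : Fin m → ℂ) : Fin m → ℂ :=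
  fun i => Complex.exp (complexPairing J (γ i) v) * z i

end Gale

/-- The complement `U_ℂ(K)` of the complex coordinate subspace arrangement defined by `K`. -/
def UCset {m : ℕ} (K : SimplicialComplexOn m) : Set (Fin m → ℂ) :=
  Set.univ \ ⋃ I ∈ {I : Finset (Fin m) | I ∉ K}, {z | ∀ i ∈ I, z i = 0}

theorem isOpen_UCset {m : ℕ} (K : SimplicialComplexOn m) : IsOpen (UCset K) := by
  refine isOpen_univ.sdiff (Set.Finite.isClosed_biUnion (Set.toFinite _) fun I _ => ?_)
  simp only [Set.ofPred_forall]
  exact isClosed_iInter fun i => isClosed_iInter fun _ =>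
    isClosed_eq (continuous_apply i) continuous_const

/-- `U_ℂ(K)` as an open subset of `ℂᵐ`; in particular it is a complex manifold. -/
def UC {m : ℕ} (K : SimplicialComplexOn m) : TopologicalSpace.Opens (Fin m → ℂ) :=
  ⟨UCset K, isOpen_UCset K⟩

section Action

variable {V : Type*} [AddCommGroup V] [Module ℝ V] {m : ℕ}

theorem expMap_mem (K : SimplicialComplexOn m) (γ : Fin m → Module.Dual ℝ V) (J : V →ₗ[ℝ] V)
    (v : V) {z : Fin m → ℂ} (hz : z ∈ UC K) : expMap γ J v z ∈ UC K := by
  have h : z ∈ UCset K := hz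
  change expMap γ J v z ∈ UCset K
  simpa [UCset, expMap, Complex.exp_ne_zero] using h

/-- The holomorphic exponential action of the additive group of `V`, with the complex structure
`J`, on `U_ℂ(K)`. -/
@[reducible] def expAction (K : SimplicialComplexOn m) (γ : Fin m → Module.Dual ℝ V)
    (J : V →ₗ[ℝ] V) : AddAction V (UC K) where
  vadd v z := ⟨expMap γ J v z, expMap_mem K γ J v z.2⟩
  zero_vadd z := by
    apply Subtype.ext
    funext i
    change expMap γ J 0 z i = _
    simp [expMap, complexPairing]
  add_vadd v w z := by
    apply Subtype.ext
    funext i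
    change expMap γ J (v + w) z i = expMap γ J v (expMap γ J w z) i
    simp only [expMap, complexPairing, map_add, Complex.ofReal_add]
    rw [← mul_assoc, ← Complex.exp_add]
    congr 2
    ring

/-- The equivalence relation on `U_ℂ(K)` whose classes are the orbits of the holomorphic
exponential action. -/
def orbitSetoid (K : SimplicialComplexOn m) (γ : Fin m → Module.Dual ℝ V)
    (J : V →ₗ[ℝ] V) : Setoid (UC K) :=
  letI := expAction K γ J
  AddAction.orbitRel V (UC K)

/-- The orbit space `U_ℂ(K) / V` (it carries the quotient topology). -/
abbrev OrbitSpace (K : SimplicialComplexOn m) (γ : Fin m → Module.Dual ℝ V)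
    (J : V →ₗ[ℝ] V) : Type :=
  Quotient (orbitSetoid K γ J)

end Action

/-- The polyhedral product `(X, A)^K` of a pair of subsets `A ⊆ X` of a space `T`. -/
def polyhedralProduct {T : Type*} {m : ℕ} (X A : Set T) (K : SimplicialComplexOn m) :
    Set (Fin m → T) :=
  ⋃ I ∈ {I : Finset (Fin m) | I ∈ K}, {x | ∀ i, x i ∈ X ∧ (i ∉ I → x i ∈ A)}

/-- The moment-angle complex `Z_K = (D², S¹)^K`, with `D²` the closed unit disc in `ℂ` and `S¹`
the unit circle. -/
def momentAngle {m : ℕ} (K : SimplicialComplexOn m) : Set (Fin m → ℂ) :=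
  polyhedralProduct (Metric.closedBall (0 : ℂ) 1) (Metric.sphere (0 : ℂ) 1) K

end MomentAngle

end

open MomentAngle

/-! On absolute values, `v` adds `γ i v` to each `log ‖z i‖`, and by Gale duality these translations
are exactly the linear relations among the `a i`. If `z` vanishes precisely on the face `I`, moving
it into the moment-angle complex amounts to writing `∑ -log ‖z i‖ • a i` over a face containing `I`,
with nonnegative coefficients outside `I`. Completeness of the star of `I` makes this possible
(`exists_face_ge`). Two solutions differ by a relation whose signs are constrained outside two
faces, and since cones meet along common faces it vanishes (`eq_zero_of_relation`).

So each orbit meets the compact set `momentAngle K` exactly once, at a unique group element `ν z`.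
The same sign argument bounds `ν` locally, and closedness of the moment-angle complex then makes `ν`
continuous. The retraction `π z = ν z • z` is thus a model of the quotient map, which gives the
homeomorphism.

For the complex structure, affine slices transverse to the orbits serve as charts. The inverse
function theorem applies because orbit maps are immersions; continuity and equivariance of `ν` stop
a small slice from meeting an orbit twice. In these charts `π` is a linear projection, hence a
submersion. -/

namespace MomentAngle

/-! ### Linear relations and cones in a complete simplicial fan -/

section Cones

variable {E : Type*} [AddCommGroup E] [Module ℝ E] {m : ℕ} {a : Fin m → E}

theorem mem_coneOf_iff {I : Finset (Fin m)} {x : E} :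
    x ∈ coneOf a I ↔ ∃ c : Fin m → ℝ, (∀ i, 0 ≤ c i) ∧ (∀ i ∉ I, c i = 0) ∧
      ∑ i, c i • a i = x := by
  constructor
  · intro hx
    induction hx using Submodule.span_induction with
    | mem x hx =>
      obtain ⟨i, hi, rfl⟩ := hx
      refine ⟨Pi.single i 1, fun j => ?_, fun j hj => ?_, ?_⟩
      · by_cases h : j = i
        · subst h; simp
        · simp [h]
      · exact Pi.single_eq_of_ne (fun h : j = i => hj (h ▸ hi)) _
      · rw [Finset.sum_eq_single i] <;> simp +contextual
    | zero => exact ⟨0, by simp⟩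
    | add x y _ _ hx hy =>
      obtain ⟨c, h0, h1, rfl⟩ := hx
      obtain ⟨d, k0, k1, rfl⟩ := hy
      refine ⟨c + d, fun i => add_nonneg (h0 i) (k0 i), fun i hi => ?_, ?_⟩
      · simp [h1 i hi, k1 i hi]
      · simp [add_smul, Finset.sum_add_distrib]
    | smul r x _ hx =>
      obtain ⟨c, h0, h1, rfl⟩ := hx
      refine ⟨fun i => (r : ℝ) * c i, fun i => mul_nonneg r.2 (h0 i), fun i hi => ?_, ?_⟩
      · simp [h1 i hi]
      · rw [Finset.smul_sum]
        exact Finset.sum_congr rfl fun i _ => mul_smul _ _ _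
  · rintro ⟨c, h0, h1, rfl⟩
    refine Submodule.sum_mem _ fun i _ => ?_
    by_cases hi : i ∈ I
    · exact Submodule.smul_mem _ (⟨c i, h0 i⟩ : {r : ℝ // 0 ≤ r})
        (Submodule.subset_span ⟨i, hi, rfl⟩)
    · simp [h1 i hi]

theorem eq_zero_of_sum_smul_eq_zero {I : Finset (Fin m)}
    (hI : LinearIndepOn ℝ a (I : Set (Fin m))) {c : Fin m → ℝ} (hc : ∀ i ∉ I, c i = 0)
    (h : ∑ i, c i • a i = 0) : c = 0 := by
  funext i
  by_cases hi : i ∈ I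
  · refine linearIndepOn_finset_iff.1 hI c ?_ i hi
    rw [← h]
    exact Finset.sum_subset (Finset.subset_univ _) fun j _ hj => by simp [hc j hj]
  · exact hc i hi

theorem eq_of_sum_smul_eq {I : Finset (Fin m)}
    (hI : LinearIndepOn ℝ a (I : Set (Fin m))) {c d : Fin m → ℝ} (hc : ∀ i ∉ I, c i = 0)
    (hd : ∀ i ∉ I, d i = 0) (h : ∑ i, c i • a i = ∑ i, d i • a i) : c = d := by
  refine sub_eq_zero.1 (eq_zero_of_sum_smul_eq_zero hI (c := c - d) ?_ ?_)
  · intro i hi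
    simp [hc i hi, hd i hi]
  · simp [sub_smul, Finset.sum_sub_distrib, h]

variable {K : SimplicialComplexOn m}

namespace IsTriangulatedConfiguration

/-- Two faces carry representations of the same vector with nonnegative coefficients only if the
coefficients agree. -/
theorem eq_of_nonneg (h : IsTriangulatedConfiguration K a) {I J : Finset (Fin m)} (hI : I ∈ K)
    (hJ : J ∈ K) {c d : Fin m → ℝ} (hc0 : ∀ i, 0 ≤ c i) (hc : ∀ i ∉ I, c i = 0)
    (hd0 : ∀ i, 0 ≤ d i) (hd : ∀ i ∉ J, d i = 0) (hcd : ∑ i, c i • a i = ∑ i, d i • a i) :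
    c = d := by
  have hx : ∑ i, c i • a i ∈ coneOf a (I ∩ J) := by
    rw [← h.inter_eq I hI J hJ]
    exact ⟨mem_coneOf_iff.2 ⟨c, hc0, hc, rfl⟩, mem_coneOf_iff.2 ⟨d, hd0, hd, hcd.symm⟩⟩
  obtain ⟨e, -, he, hec⟩ := mem_coneOf_iff.1 hx
  have h1 : e = c := eq_of_sum_smul_eq (h.linearIndepOn I hI)
    (fun i hi => he i fun h' => hi (Finset.mem_inter.1 h').1) hc hec
  have h2 : e = d := eq_of_sum_smul_eq (h.linearIndepOn J hJ)
    (fun i hi => he i fun h' => hi (Finset.mem_inter.1 h').2) hd (hec.trans hcd)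
  exact h1 ▸ h2

/-- A linear relation that is nonpositive outside of one face and nonnegative outside of another
one is trivial. -/
theorem eq_zero_of_relation (h : IsTriangulatedConfiguration K a) {I J : Finset (Fin m)}
    (hI : I ∈ K) (hJ : J ∈ K) {c : Fin m → ℝ} (hc : ∑ i, c i • a i = 0)
    (hcI : ∀ i ∉ I, c i ≤ 0) (hcJ : ∀ i ∉ J, 0 ≤ c i) : c = 0 := by
  -- Write `c = p - q` with `p`, `q` nonnegative and supported in `I`, `J` respectively.
  have key : (fun i => max (c i) 0) = fun i => max (-c i) 0 := by
    refine h.eq_of_nonneg hI hJ (fun i => le_max_right _ _)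
      (fun i hi => max_eq_right (hcI i hi)) (fun i => le_max_right _ _)
      (fun i hi => max_eq_right (neg_nonpos.2 (hcJ i hi))) ?_
    rw [← sub_eq_zero, ← Finset.sum_sub_distrib, ← hc]
    refine Finset.sum_congr rfl fun i _ => ?_
    rw [← sub_smul]
    congr 1
    rcases le_total (c i) 0 with h0 | h0
    · rw [max_eq_right h0, max_eq_left (neg_nonneg.2 h0)]; ring
    · rw [max_eq_left h0, max_eq_right (neg_nonpos.2 h0)]; ring
  funext i
  have : max (c i) 0 = max (-c i) 0 := congrFun key i
  rcases le_total (c i) 0 with h0 | h0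
  · rw [max_eq_right h0, max_eq_left (neg_nonneg.2 h0)] at this
    simpa using this.symm
  · rwa [max_eq_left h0, max_eq_right (neg_nonpos.2 h0)] at this

/-- In a complete fan the stars of the faces are complete: every vector is a combination of the
generators of a face containing a given face `I`, with nonnegative coefficients outside of `I`. -/
theorem exists_face_ge (h : IsTriangulatedConfiguration K a) (hc : IsCompleteFan (cones K a))
    {I : Finset (Fin m)} (hI : I ∈ K) (w : E) :
    ∃ J ∈ K, I ⊆ J ∧ ∃ c : Fin m → ℝ, (∀ i ∉ J, c i = 0) ∧ (∀ i ∉ I, 0 ≤ c i) ∧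
      ∑ i, c i • a i = w := by
  classical
  set χ : Fin m → ℝ := fun i => if i ∈ I then 1 else 0 with hχ
  set u : E := ∑ i, χ i • a i with hu
  have hcov : ∀ x : E, ∃ J ∈ K, x ∈ coneOf a J := by
    intro x
    have hx : x ∈ ⋃ σ ∈ cones K a, (σ : Set E) := by rw [hc]; trivial
    simp only [Set.mem_iUnion] at hx
    obtain ⟨σ, ⟨J, hJ, rfl⟩, hx⟩ := hx
    exact ⟨J, hJ, hx⟩
  -- Push `w` far along `u`, a vector in the relative interior of the cone over `I`. Finitely many
  -- cones cover the ray, so one of them contains `w + n • u` for infinitely many `n`.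
  choose F hF hFm using fun n : ℕ => hcov (w + (n : ℝ) • u)
  obtain ⟨J, hJinf⟩ := Finite.exists_infinite_fiber F
  have hS : (F ⁻¹' {J}).Infinite := Set.infinite_coe_iff.1 hJinf
  have hmem : ∀ n ∈ F ⁻¹' {J}, ∃ c : Fin m → ℝ, (∀ i, 0 ≤ c i) ∧ (∀ i ∉ J, c i = 0) ∧
      ∑ i, c i • a i = w + (n : ℝ) • u := by
    intro n hn
    have := hFm n
    rw [show F n = J from hn] at this
    exact mem_coneOf_iff.1 this
  obtain ⟨n₁, hn₁⟩ := hS.nonempty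
  have hJ : J ∈ K := (show F n₁ = J from hn₁) ▸ hF n₁
  obtain ⟨n₂, hn₂, hlt⟩ := hS.exists_gt n₁
  have hpos : (0 : ℝ) < (n₂ : ℝ) - n₁ := sub_pos.2 (by exact_mod_cast hlt)
  obtain ⟨c₁, hc₁0, hc₁J, hc₁⟩ := hmem n₁ hn₁
  obtain ⟨c₂, hc₂0, hc₂J, hc₂⟩ := hmem n₂ hn₂
  -- Coordinates of `u` over `J`, read off from two points of the ray.
  set q : Fin m → ℝ := fun i => ((n₂ : ℝ) - n₁)⁻¹ * (c₂ i - c₁ i) with hq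
  have hqJ : ∀ i ∉ J, q i = 0 := fun i hi => by simp [hq, hc₁J i hi, hc₂J i hi]
  have hqu : ∑ i, q i • a i = u := by
    have : ∑ i, q i • a i = ((n₂ : ℝ) - n₁)⁻¹ • (∑ i, c₂ i • a i - ∑ i, c₁ i • a i) := by
      rw [← Finset.sum_sub_distrib, Finset.smul_sum]
      exact Finset.sum_congr rfl fun i _ => by rw [← sub_smul, smul_smul]
    rw [this, hc₁, hc₂, add_sub_add_left_eq_sub, ← sub_smul, smul_smul,
      inv_mul_cancel₀ hpos.ne', one_smul]
  have hq0 : ∀ i, 0 ≤ q i := by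
    intro i
    by_contra! hneg
    -- Along the ray the `i`-th coefficient is `c₁ i + (n - n₁) * q i`; with `q i < 0` it is
    -- negative beyond this bound.
    obtain ⟨N, hN⟩ := exists_nat_gt ((n₁ : ℝ) + c₁ i / (-q i))
    obtain ⟨n, hn, hNn⟩ := hS.exists_gt N
    obtain ⟨c, hc0, hcJ, hcn⟩ := hmem n hn
    have hcq : c = fun i => c₁ i + ((n : ℝ) - n₁) * q i := by
      refine eq_of_sum_smul_eq (h.linearIndepOn J hJ) hcJ
        (fun i hi => by simp [hc₁J i hi, hqJ i hi]) ?_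
      simp only [add_smul, mul_smul, Finset.sum_add_distrib]
      rw [← Finset.smul_sum, hqu, hc₁, hcn, sub_smul]
      abel
    have hci := hc0 i
    rw [hcq] at hci
    have h1 : (n₁ : ℝ) + c₁ i / (-q i) < n := hN.trans (by exact_mod_cast hNn)
    have h2 : c₁ i / (-q i) < n - n₁ := by linarith
    rw [div_lt_iff₀ (by linarith)] at h2
    simp only at hci
    linarith
  -- Both represent `u` with nonnegative coefficients over faces, so they agree; since `χ` is
  -- positive on all of `I`, this forces `I ⊆ J`.
  have hχq : χ = q := by
    refine h.eq_of_nonneg hI hJ (fun i => ?_) (fun i hi => by simp [hχ, hi]) hq0 hqJ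
      (hu.symm.trans hqu.symm)
    simp only [hχ]
    split_ifs <;> norm_num
  have hIJ : I ⊆ J := by
    intro i hi
    by_contra hiJ
    have := hqJ i hiJ
    rw [← hχq] at this
    simp [hχ, hi] at this
  -- Subtracting `n₁ • u` again changes only the coefficients in `I`.
  refine ⟨J, hJ, hIJ, fun i => c₁ i - n₁ * χ i, fun i hi => ?_, fun i hi => ?_, ?_⟩
  · have : i ∉ I := fun h' => hi (hIJ h')
    simp [hc₁J i hi, hχ, this]
  · simpa [hχ, hi] using hc₁0 i
  · simp only [sub_smul, mul_smul, Finset.sum_sub_distrib]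
    rw [← Finset.smul_sum, ← hu, hc₁]
    abel

end IsTriangulatedConfiguration

end Cones

end MomentAngle

/-! ### Local slices for holomorphic actions -/

section SliceTheorem

open Set Filter Topology

variable {E F H Z : Type*} [NormedAddCommGroup E] [NormedSpace ℂ E]
  [NormedAddCommGroup F] [NormedSpace ℂ F] [NormedAddCommGroup H] [NormedSpace ℂ H]
  [TopologicalSpace Z]

theorem OpenPartialHomeomorph.mem_contDiffGroupoid_of_contDiffOn {f : OpenPartialHomeomorph E E}
    (h : ContDiffOn ℂ ω f f.source) (h' : ContDiffOn ℂ ω f.symm f.target) :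
    f ∈ contDiffGroupoid ω 𝓘(ℂ, E) := by
  rw [contDiffGroupoid, mem_groupoid_of_pregroupoid]
  simpa [contDiffPregroupoid] using ⟨h, h'⟩

theorem OpenPartialHomeomorph.contDiffOn_of_mem_contDiffGroupoid {f : OpenPartialHomeomorph E E}
    (h : f ∈ contDiffGroupoid ω 𝓘(ℂ, E)) : ContDiffOn ℂ ω f f.source := by
  rw [contDiffGroupoid, mem_groupoid_of_pregroupoid] at h
  simpa [contDiffPregroupoid] using h.1

/-- If the orbit map at `z₀` of a holomorphic action has injective derivative, then an affine
complement to the orbit through `z₀` gives a local parametrization near `z₀`. -/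
theorem exists_slice_parametrization [FiniteDimensional ℂ E] [FiniteDimensional ℂ F]
    [FiniteDimensional ℂ H]
    (hdim : Module.finrank ℂ E = Module.finrank ℂ H + Module.finrank ℂ F)
    {act : F → E → E} (hact : ContDiff ℂ ω fun p : F × E => act p.1 p.2)
    (hzero : ∀ z, act 0 z = z) {z₀ : E}
    (hinj : Function.Injective (fderiv ℂ (fun s => act s z₀) 0)) :
    ∃ (j : H →L[ℂ] E) (e : E ≃L[ℂ] H × F) (g : OpenPartialHomeomorph E E),
      g ∈ contDiffGroupoid ω 𝓘(ℂ, E) ∧ (0 : E) ∈ g.source ∧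
        ∀ x, g x = act (e x).2 (z₀ + j (e x).1) := by
  set D := fderiv ℂ (fun s => act s z₀) 0 with hD
  obtain ⟨Q, hQ⟩ := (LinearMap.range (D : F →ₗ[ℂ] E)).exists_isCompl
  have hrank : Module.finrank ℂ H = Module.finrank ℂ Q := by
    have h1 := Submodule.finrank_add_eq_of_isCompl hQ
    have h2 := LinearMap.finrank_range_of_inj (f := (D : F →ₗ[ℂ] E)) hinj
    omega
  let j₀ : H ≃ₗ[ℂ] Q := LinearEquiv.ofFinrankEq _ _ hrank
  -- Splits `E` into a complement `Q` of the orbit's tangent space and that tangent space,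
  -- parametrized by `D`; with this choice the derivative of `f` at `0` is the identity.
  let e₀ : (H × F) ≃ₗ[ℂ] E := (j₀.prodCongr (LinearEquiv.ofInjective (D : F →ₗ[ℂ] E) hinj)).trans
    (Submodule.prodEquivOfIsCompl _ _ hQ.symm)
  let e : E ≃L[ℂ] H × F := e₀.symm.toContinuousLinearEquiv
  let j : H →L[ℂ] E := LinearMap.toContinuousLinearMap (Q.subtype ∘ₗ j₀.toLinearMap)
  have hej : ∀ x, j (e x).1 + D (e x).2 = x := by
    intro x
    change e₀ (e₀.symm x) = x
    exact e₀.apply_symm_apply x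
  let f : E → E := fun x => act (e x).2 (z₀ + j (e x).1)
  have hf : ContDiff ℂ ω f :=
    hact.comp ((contDiff_snd.comp e.contDiff).prodMk
      (contDiff_const.add (j.contDiff.comp (contDiff_fst.comp e.contDiff))))
  have hA : HasFDerivAt (fun p : F × E => act p.1 p.2)
      (fderiv ℂ (fun p : F × E => act p.1 p.2) (0, z₀)) (0, z₀) :=
    (hact.differentiable (by simp)).differentiableAt.hasFDerivAt
  set A := fderiv ℂ (fun p : F × E => act p.1 p.2) (0, z₀)
  have hA1 : A ∘L ContinuousLinearMap.inl ℂ F E = D := by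
    have h1 : HasFDerivAt (fun s : F => (s, z₀)) (ContinuousLinearMap.inl ℂ F E) 0 :=
      hasFDerivAt_prodMk_left 0 z₀
    exact (HasFDerivAt.comp (0 : F) (f := fun s : F => (s, z₀)) hA h1).fderiv.symm
  have hA2 : A ∘L ContinuousLinearMap.inr ℂ F E = ContinuousLinearMap.id ℂ E := by
    have h1 : HasFDerivAt (fun z : E => ((0 : F), z)) (ContinuousLinearMap.inr ℂ F E) z₀ :=
      hasFDerivAt_prodMk_right 0 z₀
    have h2 := HasFDerivAt.comp z₀ (f := fun z : E => ((0 : F), z)) hA h1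
    have h3 : (fun p : F × E => act p.1 p.2) ∘ (fun z : E => ((0 : F), z)) = id :=
      funext fun z => hzero z
    rw [h3] at h2
    exact h2.unique (hasFDerivAt_id z₀)
  have hf' : HasFDerivAt f ((ContinuousLinearEquiv.refl ℂ E : E ≃L[ℂ] E) : E →L[ℂ] E) 0 := by
    have h1 : HasFDerivAt (fun x : E => ((e x).2, z₀ + j (e x).1))
        (((ContinuousLinearMap.snd ℂ H F) ∘L (e : E →L[ℂ] H × F)).prod
          (j ∘L (ContinuousLinearMap.fst ℂ H F) ∘L (e : E →L[ℂ] H × F))) 0 :=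
      HasFDerivAt.prodMk
        (ContinuousLinearMap.hasFDerivAt
          ((ContinuousLinearMap.snd ℂ H F) ∘L (e : E →L[ℂ] H × F)))
        ((ContinuousLinearMap.hasFDerivAt
          (j ∘L (ContinuousLinearMap.fst ℂ H F) ∘L (e : E →L[ℂ] H × F))).const_add z₀)
    have h0 : ((e 0).2, z₀ + j (e 0).1) = ((0 : F), z₀) := by simp
    have h2 := HasFDerivAt.comp (0 : E) (f := fun x : E => ((e x).2, z₀ + j (e x).1))
      (h0 ▸ hA) h1
    refine h2.congr_fderiv ?_
    ext x
    have h3 := DFunLike.congr_fun hA1 (e x).2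
    have h4 := DFunLike.congr_fun hA2 (j (e x).1)
    simp only [ContinuousLinearMap.comp_apply, ContinuousLinearMap.inl_apply,
      ContinuousLinearMap.inr_apply, ContinuousLinearMap.id_apply] at h3 h4
    change A ((e x).2, j (e x).1) = x
    have h5 : ((e x).2, j (e x).1) = ((e x).2, (0 : E)) + ((0 : F), j (e x).1) := by simp
    rw [h5, map_add, h3, h4, add_comm, hej]
  let g := hf.contDiffAt.toOpenPartialHomeomorph f hf' (n := ω) (by simp)
  have hgf : ⇑g = f := rfl
  have hg0 : (0 : E) ∈ g.source :=
    hf.contDiffAt.mem_toOpenPartialHomeomorph_source hf' (by simp)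
  have hgt : g 0 ∈ g.target := g.map_source hg0
  have hsymm : ContDiffAt ℂ ω g.symm (g 0) := by
    refine g.contDiffAt_symm (f₀' := ContinuousLinearEquiv.refl ℂ E) hgt ?_ ?_
    · rw [g.left_inv hg0]; exact hf'
    · rw [g.left_inv hg0]; exact hf.contDiffAt
  -- The inverse is known to be analytic only at `g 0`, hence near it; shrinking to `O` puts the
  -- restriction in the groupoid.
  obtain ⟨O, hO, hOo, h0O⟩ := eventually_nhds_iff.1 (hsymm.eventually (by simp))
  refine ⟨j, e, (g.symm.restrOpen O hOo).symm, ?_, ?_, fun x => rfl⟩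
  · refine OpenPartialHomeomorph.mem_contDiffGroupoid_of_contDiffOn ?_ ?_
    · exact hf.contDiffOn
    · intro y hy
      have hyO : y ∈ O := by
        have : y ∈ (g.symm.restrOpen O hOo).source := hy
        rw [OpenPartialHomeomorph.restrOpen_source] at this
        exact this.2
      exact (hO y hyO).contDiffWithinAt
  · have h1 : g 0 ∈ (g.symm.restrOpen O hOo).source := by
      rw [OpenPartialHomeomorph.restrOpen_source]
      exact ⟨hgt, h0O⟩
    have h2 := (g.symm.restrOpen O hOo).map_source h1
    have h3 : (g.symm.restrOpen O hOo) (g 0) = 0 := g.left_inv hg0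
    rw [h3] at h2
    exact h2

end SliceTheorem

theorem StructureGroupoid.subtypeRestr_mem_maximalAtlas_of_mem_maximalAtlas {M H : Type*}
    [TopologicalSpace M] [TopologicalSpace H] [ChartedSpace H M] {G : StructureGroupoid H}
    [HasGroupoid M G] [ClosedUnderRestriction G] {e : OpenPartialHomeomorph M H}
    {s : TopologicalSpace.Opens M} (hs : Nonempty s) (he : e ∈ G.maximalAtlas M) :
    e.subtypeRestr hs ∈ G.maximalAtlas s := by
  have key : ∀ f f' : OpenPartialHomeomorph M H, f.symm ≫ₕ f' ∈ G →
      (f.subtypeRestr hs).symm ≫ₕ f'.subtypeRestr hs ∈ G := fun f f' h =>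
    G.mem_of_eqOnSource
      (closedUnderRestriction' h (f.isOpen_inter_preimage_symm s.2))
      (f.subtypeRestr_symm_trans_subtypeRestr hs f')
  intro e' he'
  obtain ⟨x, rfl⟩ := TopologicalSpace.Opens.chart_eq hs he'
  exact ⟨key _ _ (he _ (chart_mem_atlas H (x : M))).1, key _ _ (he _ (chart_mem_atlas H (x : M))).2⟩

/-! ### The complex structure on the orbit space -/

section QuotientManifold

open Set Filter Topology

universe u

variable {E F : Type u} {H Z : Type*} [NormedAddCommGroup E] [NormedSpace ℂ E]
  [NormedAddCommGroup F] [NormedSpace ℂ F] [NormedAddCommGroup H] [NormedSpace ℂ H]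
  [TopologicalSpace Z]

/-- A chart `cod` of the orbit space, adapted to the quotient map `π : U → Z`: it is inverse to the
restriction of `π` to an affine slice through `z₀`, and `π` is a linear projection with respect to
`cod` and a holomorphic chart `dom` of `U` around `z₀`. -/
structure SliceChart (F H : Type*) [NormedAddCommGroup F] [NormedSpace ℂ F]
    [NormedAddCommGroup H] [NormedSpace ℂ H] (U : Set E) (π : E → Z) (z₀ : E) where
  dom : OpenPartialHomeomorph E E
  cod : OpenPartialHomeomorph Z H
  equiv : E ≃L[ℂ] H × F
  incl : H →L[ℂ] E
  dom_mem : dom ∈ contDiffGroupoid ω 𝓘(ℂ, E)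
  mem_dom : z₀ ∈ dom.source
  dom_subset : dom.source ⊆ U
  map_dom : ∀ z ∈ dom.source, π z ∈ cod.source
  cod_map : ∀ z ∈ dom.source, cod (π z) = (equiv (dom z)).1
  slice_mem : ∀ y ∈ cod.target, z₀ + incl y ∈ dom.source
  map_slice : ∀ y ∈ cod.target, π (z₀ + incl y) = cod.symm y

/-- The slice parametrization is only locally injective, so a distant group element could still
carry one slice point to another. Equivariance of `ν` excludes this: such an element is a difference
of two values of `ν` on the slice, which is small by continuity. The slice then embeds into `Z` with
open image. -/
theorem nonempty_sliceChart [FiniteDimensional ℂ E] [FiniteDimensional ℂ F]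
    [FiniteDimensional ℂ H]
    (hdim : Module.finrank ℂ E = Module.finrank ℂ H + Module.finrank ℂ F)
    {act : F → E → E} (hact : ContDiff ℂ ω fun p : F × E => act p.1 p.2)
    (hzero : ∀ z, act 0 z = z) {U : Set E} (hUo : IsOpen U)
    {ν : E → F} (hν : ContinuousOn ν U) (hνact : ∀ z ∈ U, ∀ s, ν (act s z) = ν z - s)
    {π : E → Z} (hπ : ContinuousOn π U) (hπo : ∀ O ⊆ U, IsOpen O → IsOpen (π '' O))
    (hπact : ∀ z ∈ U, ∀ w ∈ U, π z = π w ↔ ∃ s, act s z = w)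
    {z₀ : E} (hz₀ : z₀ ∈ U) (hinj : Function.Injective (fderiv ℂ (fun s => act s z₀) 0)) :
    Nonempty (SliceChart F H U π z₀) := by
  obtain ⟨j, e, g, hg, hg0, hgf⟩ := exists_slice_parametrization (H := H) hdim hact hzero hinj
  have hslice : ∀ y, g (e.symm (y, 0)) = z₀ + j y := fun y => by
    rw [hgf, e.apply_symm_apply]; exact hzero _
  have hgz : g 0 = z₀ := by
    have := hslice 0
    rwa [map_zero, add_zero, Prod.mk_zero_zero, map_zero] at this
  -- a box on which the parametrization is injective and takes values in `U`
  have hsrc : e.symm ⁻¹' (g.source ∩ g ⁻¹' U) ∈ 𝓝 ((0 : H), (0 : F)) := by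
    refine e.symm.continuous.continuousAt.preimage_mem_nhds ?_
    rw [Prod.mk_zero_zero, map_zero]
    exact (g.isOpen_inter_preimage hUo).mem_nhds ⟨hg0, by rw [mem_preimage, hgz]; exact hz₀⟩
  obtain ⟨r, hr, hrsub⟩ := Metric.mem_nhds_iff.1 hsrc
  have hjc : Tendsto (fun y => z₀ + j y) (𝓝 0) (𝓝 z₀) := by
    have : Continuous fun y => z₀ + j y := by fun_prop
    simpa using this.tendsto 0
  have hνc : ∀ᶠ y in 𝓝 (0 : H), dist (ν (z₀ + j y)) (ν z₀) < r / 2 :=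
    ((hν.continuousAt (hUo.mem_nhds hz₀)).tendsto.comp hjc).eventually
      (Metric.ball_mem_nhds _ (half_pos hr))
  -- Values of `ν` on the slice lie within `r / 2` of `ν z₀`, so two of them differ by less than
  -- `r`, the radius of the box in `F`.
  obtain ⟨r', hr', hr'ν⟩ := Metric.eventually_nhds_iff_ball.1 hνc
  set B : Set H := Metric.ball 0 (min r r') with hB
  set A : Set F := Metric.ball 0 r with hA
  have h0B : (0 : H) ∈ B := Metric.mem_ball_self (lt_min hr hr')
  have h0A : (0 : F) ∈ A := Metric.mem_ball_self hr
  have hBA : ∀ y ∈ B, ∀ s ∈ A, e.symm (y, s) ∈ g.source ∧ g (e.symm (y, s)) ∈ U := by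
    intro y hy s hs
    refine hrsub (show (y, s) ∈ Metric.ball ((0 : H), (0 : F)) r from ?_)
    rw [← ball_prod_same]
    exact ⟨Metric.ball_subset_ball (min_le_left _ _) hy, hs⟩
  have hBU : ∀ y ∈ B, z₀ + j y ∈ U := fun y hy => hslice y ▸ (hBA y hy 0 h0A).2
  have hgact : ∀ y s, g (e.symm (y, s)) = act s (z₀ + j y) := fun y s => by
    rw [hgf, e.apply_symm_apply]
  have hψinj : InjOn (fun y => π (z₀ + j y)) B := by
    intro y hy y' hy' hyy'
    obtain ⟨s, hs⟩ := (hπact _ (hBU y hy) _ (hBU y' hy')).1 hyy'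
    have hsA : s ∈ A := by
      have h1 := hνact _ (hBU y hy) s
      rw [hs] at h1
      have h2 : s = ν (z₀ + j y) - ν (z₀ + j y') := by rw [h1]; abel
      have h3 := hr'ν y (Metric.ball_subset_ball (min_le_right _ _) hy)
      have h4 := hr'ν y' (Metric.ball_subset_ball (min_le_right _ _) hy')
      rw [hA, mem_ball_zero_iff, h2, ← dist_eq_norm]
      have := dist_triangle_right (ν (z₀ + j y)) (ν (z₀ + j y')) (ν z₀)
      linarith
    have h1 : g (e.symm (y, s)) = g (e.symm (y', 0)) := by rw [hgact, hs, hslice]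
    have h2 := e.symm.injective (g.injOn (hBA y hy s hsA).1 (hBA y' hy' 0 h0A).1 h1)
    exact (Prod.ext_iff.1 h2).1
  have hbox : ∀ O ⊆ B, IsOpen O → IsOpen (e.symm '' (O ×ˢ A)) := fun O _ hO =>
    e.symm.toHomeomorph.isOpenMap _ (hO.prod Metric.isOpen_ball)
  -- Thickening along orbits does not change the image under `π`, and the thickened slice is open in
  -- `E`.
  have himage : ∀ O ⊆ B, (fun y => π (z₀ + j y)) '' O = π '' (g '' (e.symm '' (O ×ˢ A))) := by
    intro O hO
    ext x
    constructor
    · rintro ⟨y, hy, rfl⟩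
      exact ⟨_, ⟨_, ⟨(y, 0), ⟨hy, h0A⟩, rfl⟩, rfl⟩, by rw [hslice]⟩
    · rintro ⟨_, ⟨_, ⟨⟨y, s⟩, ⟨hy, hs⟩, rfl⟩, rfl⟩, rfl⟩
      refine ⟨y, hy, ?_⟩
      exact (hπact _ (hBU y (hO hy)) _ (hBA y (hO hy) s hs).2).2 ⟨s, (hgact y s).symm⟩
  have hψopen : ∀ O ⊆ B, IsOpen O → IsOpen ((fun y => π (z₀ + j y)) '' O) := by
    intro O hO hOo
    rw [himage O hO]
    refine hπo _ ?_ (g.isOpen_image_of_subset_source (hbox O hO hOo) ?_)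
    · rintro _ ⟨_, ⟨⟨y, s⟩, ⟨hy, hs⟩, rfl⟩, rfl⟩
      exact (hBA y (hO hy) s hs).2
    · rintro _ ⟨⟨y, s⟩, ⟨hy, hs⟩, rfl⟩
      exact (hBA y (hO hy) s hs).1
  have hψc : ContinuousOn (fun y => π (z₀ + j y)) B :=
    hπ.comp (by fun_prop) fun y hy => hBU y hy
  let ψ : OpenPartialHomeomorph H Z := OpenPartialHomeomorph.ofContinuousOpenRestrict
    hψinj.toPartialEquiv hψc (by
      intro O hO
      have h1 : IsOpen ((↑) '' O : Set H) := Metric.isOpen_ball.isOpenMap_subtype_val O hO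
      have h2 := hψopen _ (by rintro _ ⟨y, -, rfl⟩; exact y.2) h1
      rw [← image_comp] at h2
      exact h2) Metric.isOpen_ball
  have hψs : ψ.source = B := rfl
  have hψf : ∀ y, ψ y = π (z₀ + j y) := fun _ => rfl
  set S := e.symm '' (B ×ˢ A) with hS
  have hSo : IsOpen S := hbox B subset_rfl Metric.isOpen_ball
  have hSg : S ⊆ g.source := by
    rintro _ ⟨⟨y, s⟩, ⟨hy, hs⟩, rfl⟩
    exact (hBA y hy s hs).1
  have hmem : ∀ x ∈ S, g x ∈ (g.restr S).symm.source := by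
    intro x hx
    refine (g.restr S).map_source (x := x) ?_
    rw [g.restr_source' S hSo]
    exact ⟨hSg hx, hx⟩
  have hdom : ∀ z ∈ (g.restr S).symm.source, ∃ y ∈ B, ∃ s ∈ A, z = g (e.symm (y, s)) ∧
      (g.restr S).symm z = e.symm (y, s) := by
    intro z hz
    have h1 := (g.restr S).map_target hz
    have h3 : g ((g.restr S).symm z) = z := (g.restr S).right_inv hz
    rw [g.restr_source' S hSo] at h1
    obtain ⟨⟨y, s⟩, ⟨hy, hs⟩, h2⟩ := h1.2
    exact ⟨y, hy, s, hs, by rw [h2, h3], h2.symm⟩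
  have hπg : ∀ y ∈ B, ∀ s ∈ A, π (g (e.symm (y, s))) = ψ y := by
    intro y hy s hs
    rw [hψf]
    exact ((hπact _ (hBU y hy) _ (hBA y hy s hs).2).2 ⟨s, (hgact y s).symm⟩).symm
  refine ⟨⟨(g.restr S).symm, ψ.symm, e, j, ?_, ?_, ?_, ?_, ?_, ?_, ?_⟩⟩
  · exact (contDiffGroupoid ω 𝓘(ℂ, E)).symm (closedUnderRestriction' hg hSo)
  · have h1 := hmem _ ⟨(0, 0), ⟨h0B, h0A⟩, rfl⟩
    rwa [hslice, map_zero, add_zero] at h1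
  · intro z hz
    obtain ⟨y, hy, s, hs, rfl, -⟩ := hdom z hz
    exact (hBA y hy s hs).2
  · intro z hz
    obtain ⟨y, hy, s, hs, rfl, -⟩ := hdom z hz
    rw [hπg y hy s hs]
    exact ψ.map_source hy
  · intro z hz
    obtain ⟨y, hy, s, hs, rfl, h⟩ := hdom z hz
    rw [hπg y hy s hs, h, e.apply_symm_apply]
    exact ψ.left_inv hy
  · intro y hy
    have h1 := hmem _ ⟨(y, 0), ⟨hy, h0A⟩, rfl⟩
    rwa [hslice] at h1
  · intro y hy
    rfl

/-- The transition maps between the slice charts are holomorphic. -/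
theorem SliceChart.contDiffOn_transition {act : F → E → E} (hact : ∀ s, ContDiff ℂ ω (act s))
    {U : Set E} (hU : ∀ z ∈ U, ∀ s, act s z ∈ U) {π : E → Z}
    (hπact : ∀ z ∈ U, ∀ w ∈ U, π z = π w ↔ ∃ s, act s z = w)
    {z₀ z₁ : E} (c₀ : SliceChart F H U π z₀) (c₁ : SliceChart F H U π z₁) :
    ContDiffOn ℂ ω (c₀.cod.symm.trans c₁.cod) (c₀.cod.symm.trans c₁.cod).source := by
  intro y hy
  rw [OpenPartialHomeomorph.trans_source] at hy
  have hy₀ : y ∈ c₀.cod.target := hy.1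
  have hy₁ : c₀.cod.symm y ∈ c₁.cod.source := hy.2
  have hw := c₀.dom_subset (c₀.slice_mem y hy₀)
  set y₁ := c₁.cod (c₀.cod.symm y)
  have hy₁' : y₁ ∈ c₁.cod.target := c₁.cod.map_source hy₁
  have hw₁ := c₁.slice_mem _ hy₁'
  -- One `s`, chosen at `y`, serves for all nearby `y'`: since `π` is orbit-invariant, the
  -- transition map is locally the projection of the chart `c₁.dom` after the fixed translation `act
  -- s`. Holomorphic dependence of `s` on `y'` is not needed.
  obtain ⟨s, hs⟩ := (hπact _ hw _ (c₁.dom_subset hw₁)).1 <| by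
    rw [c₀.map_slice y hy₀, c₁.map_slice _ hy₁', c₁.cod.left_inv hy₁]
  have hsm : ContDiff ℂ ω fun y' => act s (z₀ + c₀.incl y') :=
    (hact s).comp (contDiff_const.add c₀.incl.contDiff)
  have hat : ContDiffAt ℂ ω c₁.dom (act s (z₀ + c₀.incl y)) := by
    rw [hs]
    exact (OpenPartialHomeomorph.contDiffOn_of_mem_contDiffGroupoid c₁.dom_mem).contDiffAt
      (c₁.dom.open_source.mem_nhds hw₁)
  have hcomp : ContDiffAt ℂ ω
      (fun y' => (c₁.equiv (c₁.dom (act s (z₀ + c₀.incl y')))).1) y :=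
    contDiff_fst.contDiffAt.comp y
      (c₁.equiv.contDiff.contDiffAt.comp y (hat.comp y hsm.contDiffAt))
  refine (hcomp.congr_of_eventuallyEq ?_).contDiffWithinAt
  have hev : ∀ᶠ y' in 𝓝 y, act s (z₀ + c₀.incl y') ∈ c₁.dom.source :=
    hsm.continuous.continuousAt.eventually
      (c₁.dom.open_source.mem_nhds (show act s (z₀ + c₀.incl y) ∈ _ from hs ▸ hw₁))
  filter_upwards [hev, c₀.cod.open_target.mem_nhds hy₀] with y' h1 h2
  have h3 := c₀.dom_subset (c₀.slice_mem y' h2)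
  rw [← c₁.cod_map _ h1, ← (hπact _ h3 _ (hU _ h3 s)).2 ⟨s, rfl⟩, c₀.map_slice y' h2]
  rfl

/-- The orbit space of a free and proper holomorphic action of a vector group is a complex manifold,
and the quotient map is a holomorphic submersion.  Freeness and properness are witnessed by a
continuous equivariant map `ν` to the group. -/
theorem exists_chartedSpace_isSubmersion [FiniteDimensional ℂ E] [FiniteDimensional ℂ F]
    [FiniteDimensional ℂ H]
    (hdim : Module.finrank ℂ E = Module.finrank ℂ H + Module.finrank ℂ F)
    {act : F → E → E} (hact : ContDiff ℂ ω fun p : F × E => act p.1 p.2)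
    (hzero : ∀ z, act 0 z = z) (U : TopologicalSpace.Opens E)
    (hU : ∀ z ∈ U, ∀ s, act s z ∈ U)
    (hinj : ∀ z ∈ U, Function.Injective (fderiv ℂ (fun s => act s z) 0))
    {ν : E → F} (hν : ContinuousOn ν U) (hνact : ∀ z ∈ U, ∀ s, ν (act s z) = ν z - s)
    {π : E → Z} (hπ : ContinuousOn π U) (hπo : ∀ O ⊆ (U : Set E), IsOpen O → IsOpen (π '' O))
    (hπact : ∀ z ∈ U, ∀ w ∈ U, π z = π w ↔ ∃ s, act s z = w) (hπsurj : ∀ x, ∃ z ∈ U, π z = x) :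
    ∃ _ : ChartedSpace H Z, IsManifold 𝓘(ℂ, H) ω Z ∧
      Manifold.IsSubmersion 𝓘(ℂ, E) 𝓘(ℂ, H) ω (fun z : U => π z) := by
  have hc : ∀ z : U, Nonempty (SliceChart F H (U : Set E) π (z : E)) := fun z =>
    nonempty_sliceChart hdim hact hzero U.isOpen hν hνact hπ hπo hπact z.2 (hinj z z.2)
  let c := fun z : U => (hc z).some
  choose lift hliftU hlift using hπsurj
  have hsource : ∀ z : U, π z ∈ (c z).cod.source := fun z => (c z).map_dom _ (c z).mem_dom
  -- The atlas has a slice chart for every `z` in `U`, not only for the chosen lifts, so the adapted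
  -- pair at any `z` is available for the submersion claim.
  let inst : ChartedSpace H Z :=
    { atlas := range fun z => (c z).cod
      chartAt := fun x => (c ⟨lift x, hliftU x⟩).cod
      mem_chart_source := fun x => by
        have := hsource ⟨lift x, hliftU x⟩
        rwa [hlift] at this
      chart_mem_atlas := fun x => ⟨_, rfl⟩ }
  have hman : IsManifold 𝓘(ℂ, H) ω Z := by
    refine isManifold_of_contDiffOn _ _ _ ?_
    rintro _ _ ⟨z₀, rfl⟩ ⟨z₁, rfl⟩
    have h := (c z₀).contDiffOn_transition (fun s => hact.comp (contDiff_const.prodMk contDiff_id))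
      hU hπact (c z₁)
    simpa using h
  refine ⟨inst, hman, F, inferInstance, inferInstance, fun z => ?_⟩
  have hne : Nonempty U := ⟨z⟩
  refine Manifold.IsSubmersionAtOfComplement.mk_of_charts (c z).equiv
    ((c z).dom.subtypeRestr hne) (c z).cod ?_ (hsource z) ?_ ?_ ?_ ?_
  · rw [OpenPartialHomeomorph.subtypeRestr_source]
    exact (c z).mem_dom
  · exact StructureGroupoid.subtypeRestr_mem_maximalAtlas_of_mem_maximalAtlas hne
      (StructureGroupoid.mem_maximalAtlas_of_mem_groupoid _ (c z).dom_mem)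
  · exact IsManifold.subset_maximalAtlas ⟨z, rfl⟩
  · intro w hw
    rw [OpenPartialHomeomorph.subtypeRestr_source] at hw
    exact (c z).map_dom _ hw
  · intro x hx
    have hx' : x ∈ ((c z).dom.subtypeRestr hne).target := by simpa using hx
    have h1 := ((c z).dom.subtypeRestr hne).map_target hx'
    rw [OpenPartialHomeomorph.subtypeRestr_source] at h1
    have h2 := (c z).cod_map _ h1
    have h3 := ((c z).dom.subtypeRestr hne).right_inv hx'
    rw [OpenPartialHomeomorph.subtypeRestr_coe] at h3
    have h4 : (c z).dom (((c z).dom.subtypeRestr hne).symm x : U) = x := h3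
    rw [h4] at h2
    simpa using h2

end QuotientManifold

namespace MomentAngle

open Set Filter Topology

/-! ### The arrangement complement and the moment-angle complex -/

section Spaces

variable {m : ℕ} {K : SimplicialComplexOn m}

theorem mem_UCset_iff {z : Fin m → ℂ} : z ∈ UCset K ↔ ∃ I ∈ K, ∀ i, z i = 0 ↔ i ∈ I := by
  classical
  simp only [UCset, Set.mem_sdiff, mem_univ, true_and, mem_iUnion, not_exists]
  constructor
  · intro h
    refine ⟨Finset.univ.filter fun i => z i = 0, ?_, by simp⟩
    by_contra hI
    exact h _ hI fun i hi => (Finset.mem_filter.1 hi).2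
  · rintro ⟨I, hI, hz⟩ I' hI' hz'
    exact hI' (K.down_closed hI fun i hi => (hz i).1 (hz' i hi))

theorem mem_momentAngle_iff {z : Fin m → ℂ} :
    z ∈ momentAngle K ↔ ∃ I ∈ K, (∀ i, ‖z i‖ ≤ 1) ∧ ∀ i ∉ I, ‖z i‖ = 1 := by
  simp [momentAngle, polyhedralProduct, forall_and, and_left_comm]

theorem momentAngle_subset_UCset : momentAngle K ⊆ UCset K := by
  classical
  intro z hz
  obtain ⟨I, hI, -, hz⟩ := mem_momentAngle_iff.1 hz
  refine mem_UCset_iff.2 ⟨Finset.univ.filter fun i => z i = 0, K.down_closed hI ?_, by simp⟩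
  intro i hi
  by_contra h
  have := hz i h
  simp [(Finset.mem_filter.1 hi).2] at this

theorem isCompact_momentAngle : IsCompact (momentAngle K) := by
  classical
  refine (Set.toFinite _).isCompact_biUnion fun I _ => ?_
  have : {x : Fin m → ℂ | ∀ i, x i ∈ Metric.closedBall (0 : ℂ) 1 ∧
      (i ∉ I → x i ∈ Metric.sphere (0 : ℂ) 1)} =
      Set.pi univ fun i => if i ∈ I then Metric.closedBall (0 : ℂ) 1 else Metric.sphere 0 1 := by
    ext x
    simp only [mem_ofPred_eq, mem_univ_pi]
    refine forall_congr' fun i => ?_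
    by_cases hi : i ∈ I
    · simp [hi]
    · simpa [hi] using fun h : ‖x i‖ = 1 => h.le
  rw [this]
  refine isCompact_univ_pi fun i => ?_
  split_ifs
  · exact isCompact_closedBall _ _
  · exact isCompact_sphere _ _

end Spaces

/-! ### Orbits of the exponential action via Gale duality -/

section Exponential

variable {V W : Type*} [AddCommGroup V] [Module ℝ V] [AddCommGroup W] [Module ℝ W] {m : ℕ}
  {γ : Fin m → Module.Dual ℝ V} {a : Fin m → Module.Dual ℝ W} {K : SimplicialComplexOn m}
  {J : V →ₗ[ℝ] V}

theorem expMap_zero (z : Fin m → ℂ) : expMap γ J 0 z = z := by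
  funext i
  simp [expMap, complexPairing]

theorem expMap_add (v w : V) (z : Fin m → ℂ) :
    expMap γ J (v + w) z = expMap γ J v (expMap γ J w z) := by
  funext i
  simp only [expMap, complexPairing, map_add, Complex.ofReal_add]
  rw [← mul_assoc, ← Complex.exp_add]
  congr 2
  ring

theorem norm_expMap_apply (v : V) (z : Fin m → ℂ) (i : Fin m) :
    ‖expMap γ J v z i‖ = Real.exp (γ i v) * ‖z i‖ := by
  simp [expMap, complexPairing, Complex.norm_exp]

namespace IsGaleDual

theorem sum_smul_eq_zero (h : IsGaleDual γ a) (v : V) : ∑ i, γ i v • a i = 0 := by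
  have := (h.exact (LinearMap.pi γ v)).2 ⟨v, rfl⟩
  simpa [Fintype.linearCombination_apply] using this

theorem exists_eq (h : IsGaleDual γ a) {c : Fin m → ℝ} (hc : ∑ i, c i • a i = 0) :
    ∃ v, ∀ i, γ i v = c i := by
  obtain ⟨v, hv⟩ := (h.exact c).1 (by simpa [Fintype.linearCombination_apply] using hc)
  exact ⟨v, fun i => congrFun hv i⟩

theorem eq_zero (h : IsGaleDual γ a) {v : V} (hv : ∀ i, γ i v = 0) : v = 0 :=
  h.injective (by funext i; simp [hv i])

theorem finrank_eq [FiniteDimensional ℝ V] [FiniteDimensional ℝ W] (h : IsGaleDual γ a) :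
    m = Module.finrank ℝ W + Module.finrank ℝ V := by
  have h1 := LinearMap.finrank_range_add_finrank_ker (Fintype.linearCombination ℝ a)
  rw [LinearMap.range_eq_top.2 h.surjective, finrank_top, Subspace.dual_finrank_eq,
    LinearMap.exact_iff.1 h.exact, LinearMap.finrank_range_of_inj h.injective,
    Module.finrank_fin_fun] at h1
  exact h1.symm

/-- The numbers `γ i v` are the coefficients of a relation among the `a i`. This underlies
uniqueness of the orbit representative, boundedness of `ν`, and, with `I = I'`, injectivity of the
infinitesimal action. -/
theorem eq_zero_of_nonpos_of_nonneg (h : IsGaleDual γ a) (hK : IsTriangulatedConfiguration K a)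
    {I I' : Finset (Fin m)} (hI : I ∈ K) (hI' : I' ∈ K) {v : V} (hv : ∀ i ∉ I, γ i v ≤ 0)
    (hv' : ∀ i ∉ I', 0 ≤ γ i v) : v = 0 :=
  h.eq_zero fun i =>
    congrFun (hK.eq_zero_of_relation hI hI' (h.sum_smul_eq_zero v) hv hv') i

/-- Every orbit of the exponential action on `U_ℂ(K)` meets the moment-angle complex. -/
theorem exists_expMap_mem (h : IsGaleDual γ a) (hK : IsTriangulatedConfiguration K a)
    (hc : IsCompleteFan (cones K a)) (J : V →ₗ[ℝ] V) {z : Fin m → ℂ} (hz : z ∈ UCset K) :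
    ∃ v, expMap γ J v z ∈ momentAngle K := by
  obtain ⟨I, hI, hzI⟩ := mem_UCset_iff.1 hz
  -- The goal is `log ‖z i‖ + γ i v = -c i` outside `I`. For `i ∈ I` the coordinate is zero whatever
  -- `v` is, so the value `log 0 = 0` and the sign of `c i` there are harmless.
  obtain ⟨I', hI', hII', c, hcI', hcI, hsum⟩ :=
    hK.exists_face_ge hc hI (∑ i, -Real.log ‖z i‖ • a i)
  obtain ⟨v, hv⟩ := h.exists_eq (c := fun i => -Real.log ‖z i‖ - c i) (by
    rw [← sub_eq_zero.2 hsum.symm, ← Finset.sum_sub_distrib]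
    exact Finset.sum_congr rfl fun i _ => sub_smul (-Real.log ‖z i‖) (c i) (a i))
  have hnorm : ∀ i ∉ I, ‖expMap γ J v z i‖ = Real.exp (-c i) := by
    intro i hi
    have hpos : 0 < ‖z i‖ := norm_pos_iff.2 fun h0 => hi ((hzI i).1 h0)
    rw [norm_expMap_apply, hv, sub_eq_add_neg, Real.exp_add, Real.exp_neg, Real.exp_log hpos]
    field_simp
  refine ⟨v, mem_momentAngle_iff.2 ⟨I', hI', fun i => ?_, fun i hi => ?_⟩⟩
  · by_cases hi : i ∈ I
    · rw [norm_expMap_apply, (hzI i).2 hi]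
      simp
    · rw [hnorm i hi]
      exact Real.exp_le_one_iff.2 (neg_nonpos.2 (hcI i hi))
  · rw [hnorm i fun h' => hi (hII' h'), hcI' i hi]
    simp

/-- Every orbit of the exponential action meets the moment-angle complex at most once. -/
theorem eq_of_expMap_mem (h : IsGaleDual γ a) (hK : IsTriangulatedConfiguration K a)
    {z : Fin m → ℂ} {v w : V} (hv : expMap γ J v z ∈ momentAngle K)
    (hw : expMap γ J w z ∈ momentAngle K) : v = w := by
  obtain ⟨I, hI, hI1, hI2⟩ := mem_momentAngle_iff.1 hv
  obtain ⟨I', hI', hI1', hI2'⟩ := mem_momentAngle_iff.1 hw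
  simp only [norm_expMap_apply] at hI1 hI2 hI1' hI2'
  -- Comparing a coordinate of norm one with the same coordinate of norm at most one orders the two
  -- exponents; used with `v` and `w` in both roles, it gives the signs of `γ i (v - w)` outside `I`
  -- and `I'`.
  have key : ∀ {u u' : V} {i : Fin m}, Real.exp (γ i u) * ‖z i‖ = 1 →
      Real.exp (γ i u') * ‖z i‖ ≤ 1 → γ i u' ≤ γ i u := by
    intro u u' i hu hu'
    have hpos : 0 < ‖z i‖ := by
      refine (norm_nonneg _).lt_of_ne' fun h0 => ?_
      rw [h0, mul_zero] at hu
      exact zero_ne_one hu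
    rw [← hu] at hu'
    exact Real.exp_le_exp.1 (le_of_mul_le_mul_right hu' hpos)
  refine sub_eq_zero.1 (h.eq_zero_of_nonpos_of_nonneg hK hI' hI (fun i hi => ?_) fun i hi => ?_)
  · rw [map_sub]
    exact sub_nonpos.2 (key (hI2' i hi) (hI1 i))
  · rw [map_sub]
    exact sub_nonneg.2 (key (hI2 i hi) (hI1' i))

end IsGaleDual

variable {F : Type*} [NormedAddCommGroup F] [NormedSpace ℝ F] [FiniteDimensional ℝ F]

/-- A polyhedron cut out by bounds on the `γ i` with trivial recession cone is bounded. -/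
theorem IsGaleDual.exists_norm_le (h : IsGaleDual γ a) (hK : IsTriangulatedConfiguration K a)
    (e : F ≃ₗ[ℝ] V) {I I' : Finset (Fin m)} (hI : I ∈ K) (hI' : I' ∈ K) (B : ℝ) :
    ∃ C, ∀ s, (∀ i ∉ I, γ i (e s) ≤ B) → (∀ i ∉ I', -B ≤ γ i (e s)) → ‖s‖ ≤ C := by
  classical
  have hcont : ∀ i, Continuous fun s => γ i (e s) := fun i =>
    LinearMap.continuous_of_finiteDimensional (γ i ∘ₗ e.toLinearMap)
  -- A positively homogeneous measure of how far `s` violates the sign conditions. It vanishes only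
  -- at `0`, so it is at least `ε * ‖s‖`, while the assumed bounds control it from above.
  let f : F → ℝ := fun s =>
    ∑ i ∈ Iᶜ, max (γ i (e s)) 0 + ∑ i ∈ I'ᶜ, max (-γ i (e s)) 0
  have hf : Continuous f :=
    (continuous_finsetSum _ fun i _ => (hcont i).max continuous_const).add
      (continuous_finsetSum _ fun i _ => (hcont i).neg.max continuous_const)
  have hpos : ∀ s ∈ Metric.sphere (0 : F) 1, 0 < f s := by
    intro s hs
    have h1 : 0 ≤ ∑ i ∈ Iᶜ, max (γ i (e s)) 0 := Finset.sum_nonneg fun i _ => le_max_right _ _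
    have h2 : 0 ≤ ∑ i ∈ I'ᶜ, max (-γ i (e s)) 0 := Finset.sum_nonneg fun i _ => le_max_right _ _
    refine (add_nonneg h1 h2).lt_of_ne' fun h0 => ?_
    obtain ⟨h3, h4⟩ := (add_eq_zero_iff_of_nonneg h1 h2).1 h0
    rw [Finset.sum_eq_zero_iff_of_nonneg fun i _ => le_max_right _ _] at h3 h4
    have h5 : e s = 0 := by
      refine h.eq_zero_of_nonpos_of_nonneg hK hI hI' (fun i hi => ?_) fun i hi => ?_
      · exact max_eq_right_iff.1 (h3 i (Finset.mem_compl.2 hi))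
      · exact neg_nonpos.1 (max_eq_right_iff.1 (h4 i (Finset.mem_compl.2 hi)))
    rw [e.map_eq_zero_iff] at h5
    simp [h5] at hs
  obtain ⟨ε, hε, hεf⟩ := (isCompact_sphere (0 : F) 1).exists_forall_le' hf.continuousOn hpos
  refine ⟨(∑ i ∈ Iᶜ, max B 0 + ∑ i ∈ I'ᶜ, max B 0) / ε, fun s h1 h2 => ?_⟩
  rw [le_div_iff₀ hε]
  have hfs : f s ≤ ∑ i ∈ Iᶜ, max B 0 + ∑ i ∈ I'ᶜ, max B 0 := by
    refine add_le_add (Finset.sum_le_sum fun i hi => ?_) (Finset.sum_le_sum fun i hi => ?_)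
    · exact max_le_max (h1 i (Finset.mem_compl.1 hi)) le_rfl
    · exact max_le_max (neg_le.1 (h2 i (Finset.mem_compl.1 hi))) le_rfl
  refine le_trans ?_ hfs
  rcases eq_or_ne s 0 with rfl | hs
  · simp [f]
  · have hs0 : 0 < ‖s‖ := norm_pos_iff.2 hs
    have hle := hεf (‖s‖⁻¹ • s) (by simp [norm_smul, hs0.ne'])
    have hhom : f (‖s‖⁻¹ • s) = ‖s‖⁻¹ * f s := by
      simp only [f, map_smul, smul_eq_mul, mul_add, Finset.mul_sum]
      congr 1 <;> refine Finset.sum_congr rfl fun i _ => ?_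
      · rw [mul_max_of_nonneg _ _ (inv_nonneg.2 hs0.le), mul_zero]
      · rw [mul_max_of_nonneg _ _ (inv_nonneg.2 hs0.le), mul_zero, mul_neg]
    rw [hhom, inv_mul_eq_div, le_div_iff₀ hs0] at hle
    linarith

/-- The group elements carrying points near a given point of `U_ℂ(K)` into the moment-angle complex
are bounded. -/
theorem IsGaleDual.eventually_norm_le (h : IsGaleDual γ a) (hK : IsTriangulatedConfiguration K a)
    (e : F ≃ₗ[ℝ] V) {z₀ : Fin m → ℂ} (hz₀ : z₀ ∈ UCset K) :
    ∃ C, ∀ᶠ z in 𝓝 z₀, ∀ s, expMap γ J (e s) z ∈ momentAngle K → ‖s‖ ≤ C := by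
  obtain ⟨I, hI, hzI⟩ := mem_UCset_iff.1 hz₀
  -- Coordinates in `I` may be arbitrarily small near `z₀`, so only those outside `I` get a lower
  -- bound. Norm at most one then gives `γ i ≤ B` outside `I`, and norm one gives `γ i ≥ -B` outside
  -- `I'`.
  obtain ⟨B, hB⟩ : ∃ B : ℝ, ∀ i, ‖z₀ i‖ < Real.exp B ∧ (i ∉ I → Real.exp (-B) < ‖z₀ i‖) := by
    have : ∀ᶠ B : ℝ in atTop, ∀ i, ‖z₀ i‖ < Real.exp B ∧ (i ∉ I → Real.exp (-B) < ‖z₀ i‖) := by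
      refine eventually_all.2 fun i => (Real.tendsto_exp_atTop.eventually_gt_atTop _).and ?_
      by_cases hi : i ∈ I
      · simp [hi]
      · have hpos : 0 < ‖z₀ i‖ := norm_pos_iff.2 fun h0 => hi ((hzI i).1 h0)
        filter_upwards [(Real.tendsto_exp_neg_atTop_nhds_zero).eventually_lt_const hpos] with B hB _
        exact hB
    exact this.exists
  have hbd : ∀ I' : Finset (Fin m), ∃ C, I' ∈ K →
      ∀ s, (∀ i ∉ I, γ i (e s) ≤ B) → (∀ i ∉ I', -B ≤ γ i (e s)) → ‖s‖ ≤ C := by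
    intro I'
    by_cases hI' : I' ∈ K
    · obtain ⟨C, hC⟩ := h.exists_norm_le hK e hI hI' B
      exact ⟨C, fun _ => hC⟩
    · exact ⟨0, fun h' => absurd h' hI'⟩
  choose C hC using hbd
  obtain ⟨C', hC'⟩ := (Set.finite_range C).bddAbove
  refine ⟨C', ?_⟩
  have hev : ∀ᶠ z in 𝓝 z₀, ∀ i, ‖z i‖ < Real.exp B ∧ (i ∉ I → Real.exp (-B) < ‖z i‖) := by
    refine eventually_all.2 fun i => ?_
    have hc : Continuous fun z : Fin m → ℂ => ‖z i‖ := by fun_prop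
    refine (hc.continuousAt.eventually_lt_const (hB i).1).and ?_
    by_cases hi : i ∈ I
    · simp [hi]
    · filter_upwards [hc.continuousAt.eventually_const_lt ((hB i).2 hi)] with z hz _
      exact hz
  filter_upwards [hev] with z hz s hs
  obtain ⟨I', hI', h1, h2⟩ := mem_momentAngle_iff.1 hs
  simp only [norm_expMap_apply] at h1 h2
  refine (hC I' hI' s (fun i hi => ?_) fun i hi => ?_).trans (hC' ⟨I', rfl⟩)
  · have h3 := (mul_le_mul_of_nonneg_left ((hz i).2 hi).le (Real.exp_nonneg _)).trans (h1 i)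
    rw [← Real.exp_add, Real.exp_le_one_iff] at h3
    linarith
  · have h3 := (h2 i hi).symm.le.trans
      (mul_le_mul_of_nonneg_left (hz i).1.le (Real.exp_nonneg (γ i (e s))))
    rw [← Real.exp_add, Real.one_le_exp_iff] at h3
    linarith

end Exponential

end MomentAngle

/-! ### Holomorphy of the action and continuity of the orbit selection -/

namespace MomentAngle

open Set Filter Topology

/-- A real vector space of dimension `2ℓ` with a complex structure is `ℂ^ℓ`. -/
theorem exists_linearEquiv_complex {V : Type*} [AddCommGroup V] [Module ℝ V]
    [FiniteDimensional ℝ V] {J : V →ₗ[ℝ] V} (hJ : J ∘ₗ J = -LinearMap.id) {ℓ : ℕ}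
    (hdim : Module.finrank ℝ V = 2 * ℓ) :
    ∃ e : (Fin ℓ → ℂ) ≃ₗ[ℝ] V, ∀ s, e (Complex.I • s) = J (e s) := by
  let φ : ℂ →ₐ[ℝ] Module.End ℝ V := Complex.lift ⟨J, hJ⟩
  let _ : Module ℂ V := Module.compHom V φ.toRingHom
  have hsmul : ∀ (c : ℂ) (v : V), c • v = φ c v := fun _ _ => rfl
  have : IsScalarTower ℝ ℂ V := ⟨fun r c v => by rw [hsmul, hsmul, map_smul]; rfl⟩
  have : FiniteDimensional ℂ V := FiniteDimensional.right ℝ ℂ V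
  have h1 : Module.finrank ℂ (Fin ℓ → ℂ) = Module.finrank ℂ V := by
    have := Module.finrank_mul_finrank ℝ ℂ V
    rw [Complex.finrank_real_complex] at this
    rw [Module.finrank_fin_fun]
    omega
  let e : (Fin ℓ → ℂ) ≃ₗ[ℂ] V := LinearEquiv.ofFinrankEq _ _ h1
  refine ⟨e.restrictScalars ℝ, fun s => ?_⟩
  change e (Complex.I • s) = J (e s)
  rw [map_smul, hsmul]
  simp [φ]

/-- A locally bounded selection of a closed relation is continuous where it is unique. -/
theorem continuousAt_of_isClosed_of_norm_le {X F : Type*} [TopologicalSpace X]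
    [NormedAddCommGroup F] [ProperSpace F] {R : Set (F × X)} (hR : IsClosed R) {ν : X → F} {x₀ : X}
    (hν : ∀ᶠ x in 𝓝 x₀, (ν x, x) ∈ R) (huniq : ∀ s, (s, x₀) ∈ R → s = ν x₀) {C : ℝ}
    (hC : ∀ᶠ x in 𝓝 x₀, ‖ν x‖ ≤ C) : ContinuousAt ν x₀ := by
  -- Along an ultrafilter, `ν` has a limit in a compact ball; closedness puts the limit in `R`, and
  -- uniqueness identifies it.
  refine tendsto_iff_ultrafilter _ _ _ |>.2 fun g hg => ?_
  have hball : Metric.closedBall (0 : F) C ∈ g.map ν :=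
    hg (hC.mono fun x hx => mem_closedBall_zero_iff.2 hx)
  obtain ⟨s, -, hs⟩ := (isCompact_closedBall (0 : F) C).ultrafilter_le_nhds' _ hball
  have hs' : Tendsto ν g (𝓝 s) := hs
  have hlim : Tendsto (fun x => (ν x, x)) g (𝓝 (s, x₀)) := hs'.prodMk_nhds hg
  exact huniq s (hR.mem_of_tendsto hlim (hg hν)) ▸ hs'

section Action

variable {V W : Type*} [AddCommGroup V] [Module ℝ V] [AddCommGroup W] [Module ℝ W] {m : ℕ}
  {γ : Fin m → Module.Dual ℝ V} {a : Fin m → Module.Dual ℝ W} {K : SimplicialComplexOn m}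
  {J : V →ₗ[ℝ] V} {F : Type*} [NormedAddCommGroup F] [NormedSpace ℂ F] [FiniteDimensional ℂ F]

/-- The term `-i ⟨γ, J v⟩` makes the pairing complex linear: replacing `v` by `J v` gives `⟨γ, J v⟩
+ i ⟨γ, v⟩`, which is `i` times the pairing with `v`. -/
theorem exists_clm_eq_complexPairing (hJ : J ∘ₗ J = -LinearMap.id) (e : F ≃ₗ[ℝ] V)
    (he : ∀ s, e (Complex.I • s) = J (e s)) (g : Module.Dual ℝ V) :
    ∃ L : F →L[ℂ] ℂ, ∀ s, L s = complexPairing J g (e s) := by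
  have hJJ : ∀ v, J (J v) = -v := fun v => DFunLike.congr_fun hJ v
  refine ⟨LinearMap.toContinuousLinearMap
    { toFun := fun s => complexPairing J g (e s)
      map_add' := fun s t => by
        simp only [complexPairing, map_add, Complex.ofReal_add]
        ring
      map_smul' := fun c s => ?_ }, fun s => rfl⟩
  have h1 : e (c • s) = c.re • e s + c.im • J (e s) := by
    have : c • s = c.re • s + c.im • (Complex.I • s) := by
      conv_lhs => rw [← Complex.re_add_im c]
      rw [add_smul, mul_smul, Complex.coe_smul, Complex.coe_smul]
    rw [this, map_add, map_smul, map_smul, he]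
  simp only [complexPairing, h1, map_add, map_smul, hJJ, map_neg, smul_eq_mul,
    RingHom.id_apply, Complex.ofReal_add, Complex.ofReal_mul, Complex.ofReal_neg]
  conv_rhs => rw [← Complex.re_add_im c]
  linear_combination ((c.im : ℂ) * (g (J (e s)) : ℂ)) * Complex.I_sq

theorem contDiff_expMap (hJ : J ∘ₗ J = -LinearMap.id) (e : F ≃ₗ[ℝ] V)
    (he : ∀ s, e (Complex.I • s) = J (e s)) :
    ContDiff ℂ ω fun p : F × (Fin m → ℂ) => expMap γ J (e p.1) p.2 := by
  refine contDiff_pi.2 fun i => ?_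
  obtain ⟨L, hL⟩ := exists_clm_eq_complexPairing hJ e he (γ i)
  simp only [expMap, ← hL]
  exact (L.contDiff.comp contDiff_fst).cexp.mul ((contDiff_apply ℂ ℂ i).comp contDiff_snd)

/-- The derivative is `s ↦ (z i * L i s)`. On its kernel `L i s`, hence its real part `γ i (e s)`,
vanishes off the zero set of `z`, which is a face. -/
theorem injective_fderiv_expMap (hJ : J ∘ₗ J = -LinearMap.id) (e : F ≃ₗ[ℝ] V)
    (he : ∀ s, e (Complex.I • s) = J (e s)) (h : IsGaleDual γ a)
    (hK : IsTriangulatedConfiguration K a) {z : Fin m → ℂ} (hz : z ∈ UCset K) :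
    Function.Injective (fderiv ℂ (fun s => expMap γ J (e s) z) 0) := by
  choose L hL using fun i => exists_clm_eq_complexPairing hJ e he (γ i)
  have hd : HasFDerivAt (fun s => expMap γ J (e s) z)
      (ContinuousLinearMap.pi fun i => z i • L i) 0 := by
    refine hasFDerivAt_pi.2 fun i => ?_
    simp only [expMap, ← hL]
    have := ((L i).hasFDerivAt (x := 0)).cexp.mul_const (z i)
    simpa using this
  rw [hd.fderiv]
  refine (injective_iff_map_eq_zero _).2 fun s hs => ?_
  obtain ⟨I, hI, hzI⟩ := mem_UCset_iff.1 hz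
  have hγ : ∀ i ∉ I, γ i (e s) = 0 := by
    intro i hi
    have h1 : z i * L i s = 0 := congrFun hs i
    have h2 := (mul_eq_zero.1 h1).resolve_left fun h0 => hi ((hzI i).1 h0)
    rw [hL] at h2
    simpa [complexPairing] using congrArg Complex.re h2
  have h1 := h.eq_zero_of_nonpos_of_nonneg hK hI hI (fun i hi => (hγ i hi).le)
    fun i hi => (hγ i hi).ge
  exact e.map_eq_zero_iff.1 h1

theorem continuous_expMap (hJ : J ∘ₗ J = -LinearMap.id) (e : F ≃ₗ[ℝ] V)
    (he : ∀ s, e (Complex.I • s) = J (e s)) :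
    Continuous fun p : F × (Fin m → ℂ) => expMap γ J (e p.1) p.2 :=
  (contDiff_expMap hJ e he).continuous

/-- The group element carrying a point of `U_ℂ(K)` into the moment-angle complex depends
continuously on the point. -/
theorem continuousOn_of_expMap_mem (hJ : J ∘ₗ J = -LinearMap.id) (e : F ≃ₗ[ℝ] V)
    (he : ∀ s, e (Complex.I • s) = J (e s)) (h : IsGaleDual γ a)
    (hK : IsTriangulatedConfiguration K a) {ν : (Fin m → ℂ) → F}
    (hν : ∀ z ∈ UCset K, expMap γ J (e (ν z)) z ∈ momentAngle K) : ContinuousOn ν (UCset K) := by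
  have : FiniteDimensional ℝ F := FiniteDimensional.complexToReal F
  have : ProperSpace F := FiniteDimensional.proper ℝ F
  intro z₀ hz₀
  refine ContinuousAt.continuousWithinAt ?_
  obtain ⟨C, hC⟩ := h.eventually_norm_le (J := J) hK e hz₀
  have hU : ∀ᶠ z in 𝓝 z₀, z ∈ UCset K := (isOpen_UCset K).mem_nhds hz₀
  refine continuousAt_of_isClosed_of_norm_le (C := C)
    (isCompact_momentAngle.isClosed.preimage (continuous_expMap hJ e he))
    (hU.mono hν) (fun s hs => e.injective (h.eq_of_expMap_mem hK hs (hν z₀ hz₀))) ?_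
  filter_upwards [hC, hU] with z h1 h2
  exact h1 _ (hν z h2)

end Action

end MomentAngle

/-! ### The homeomorphism and the complex structure -/

theorem theorem10p6 {m ℓ : ℕ}
    {V : Type*} [AddCommGroup V] [Module ℝ V] [FiniteDimensional ℝ V]
    {W : Type*} [AddCommGroup W] [Module ℝ W] [FiniteDimensional ℝ W]
    (K : SimplicialComplexOn m)
    (γ : Fin m → Module.Dual ℝ V) (a : Fin m → Module.Dual ℝ W)
    (hgale : IsGaleDual γ a)
    (hfan : IsTriangulatedConfiguration K a)
    (hcomplete : IsCompleteFan (cones K a))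
    (J : V →ₗ[ℝ] V) (hJ : J ∘ₗ J = -LinearMap.id)
    (hdim : Module.finrank ℝ V = 2 * ℓ) :
    ∃ Φ : OrbitSpace K γ J ≃ₜ momentAngle K,
      CompactSpace (momentAngle K) ∧
      ∃ _ : ChartedSpace (EuclideanSpace ℂ (Fin (Module.finrank ℝ W + ℓ))) (momentAngle K),
        IsManifold 𝓘(ℂ, EuclideanSpace ℂ (Fin (Module.finrank ℝ W + ℓ))) ω (momentAngle K) ∧
        Manifold.IsSubmersion 𝓘(ℂ, Fin m → ℂ)
          𝓘(ℂ, EuclideanSpace ℂ (Fin (Module.finrank ℝ W + ℓ))) ω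
          (fun z : UC K => Φ (Quotient.mk (orbitSetoid K γ J) z)) := by
  obtain ⟨e, he⟩ := exists_linearEquiv_complex hJ hdim
  have hex : ∀ z, ∃ s, z ∈ UCset K → expMap γ J (e s) z ∈ momentAngle K := by
    intro z
    by_cases hz : z ∈ UCset K
    · obtain ⟨v, hv⟩ := hgale.exists_expMap_mem hfan hcomplete J hz
      exact ⟨e.symm v, fun _ => by rwa [e.apply_symm_apply]⟩
    · exact ⟨0, fun h => absurd h hz⟩
  choose ν hν using hex
  have hU : ∀ z ∈ UCset K, ∀ s, expMap γ J (e s) z ∈ UCset K := fun z hz s =>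
    expMap_mem K γ J (e s) hz
  have hνeq : ∀ z ∈ UCset K, ∀ s, expMap γ J (e s) z ∈ momentAngle K → ν z = s :=
    fun z hz s hs => e.injective (hgale.eq_of_expMap_mem hfan (hν z hz) hs)
  have hνact : ∀ z ∈ UCset K, ∀ s, ν (expMap γ J (e s) z) = ν z - s := by
    intro z hz s
    refine hνeq _ (hU z hz s) _ ?_
    rw [← expMap_add, ← map_add, sub_add_cancel]
    exact hν z hz
  have hνc : ContinuousOn ν (UCset K) := continuousOn_of_expMap_mem hJ e he hgale hfan hν
  have hν0 : ∀ z ∈ momentAngle K, ν z = 0 := fun z hz =>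
    hνeq z (momentAngle_subset_UCset hz) 0 (by rwa [map_zero, expMap_zero])
  have hone : (fun _ => 1 : Fin m → ℂ) ∈ momentAngle K :=
    mem_momentAngle_iff.2 ⟨∅, K.empty_mem, by simp, by simp⟩
  -- Off `UCset K` the value is a dummy, the all-ones point, which lies in the moment-angle complex
  -- for every `K`.
  have hexπ : ∀ z, ∃ x : momentAngle K, z ∈ UCset K → (x : Fin m → ℂ) = expMap γ J (e (ν z)) z := by
    intro z
    by_cases hz : z ∈ UCset K
    · exact ⟨⟨_, hν z hz⟩, fun _ => rfl⟩
    · exact ⟨⟨_, hone⟩, fun h => absurd h hz⟩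
  choose π hπ using hexπ
  have hcont := continuous_expMap (γ := γ) hJ e he
  have hπc : ContinuousOn π (UCset K) := by
    refine Topology.IsInducing.subtypeVal.continuousOn_iff.2 ?_
    exact (hcont.comp_continuousOn (hνc.prodMk continuousOn_id)).congr fun z hz => hπ z hz
  have hπact : ∀ z ∈ UCset K, ∀ w ∈ UCset K, π z = π w ↔ ∃ s, expMap γ J (e s) z = w := by
    intro z hz w hw
    rw [Subtype.ext_iff, hπ z hz, hπ w hw]
    constructor
    · intro h
      -- Move `z` to the common representative, then back to `w`.
      refine ⟨-ν w + ν z, ?_⟩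
      rw [map_add, expMap_add, h, ← expMap_add, ← map_add, neg_add_cancel, map_zero, expMap_zero]
    · rintro ⟨s, rfl⟩
      rw [hνact z hz, ← expMap_add, ← map_add, sub_add_cancel]
  have hπfix : ∀ x : momentAngle K, π x = x := by
    intro x
    rw [Subtype.ext_iff, hπ _ (momentAngle_subset_UCset x.2), hν0 _ x.2, map_zero, expMap_zero]
  have hπo : ∀ O ⊆ UCset K, IsOpen O → IsOpen (π '' O) := by
    intro O hO hOo
    -- The image consists of the representatives whose orbit meets `O`, a union of open conditions.
    have himage : π '' O = ⋃ s, {x : momentAngle K | expMap γ J (e s) x ∈ O} := by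
      ext x
      simp only [Set.mem_image, Set.mem_iUnion, Set.mem_ofPred_eq]
      constructor
      · rintro ⟨z, hz, hzx⟩
        rw [← hπfix x] at hzx
        obtain ⟨s, hs⟩ :=
          (hπact _ (momentAngle_subset_UCset x.2) _ (hO hz)).1 hzx.symm
        exact ⟨s, hs ▸ hz⟩
      · rintro ⟨s, hs⟩
        refine ⟨_, hs, ?_⟩
        rw [← (hπact _ (momentAngle_subset_UCset x.2) _ (hO hs)).2 ⟨s, rfl⟩, hπfix]
    rw [himage]
    exact isOpen_iUnion fun s =>
      hOo.preimage (hcont.comp (continuous_const.prodMk continuous_subtype_val))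
  have hrel : ∀ z w : UC K, (orbitSetoid K γ J) z w ↔ ∃ s, expMap γ J (e s) w = (z : Fin m → ℂ) := by
    intro z w
    constructor
    · rintro ⟨v, hv⟩
      refine ⟨e.symm v, ?_⟩
      rw [e.apply_symm_apply]
      exact congrArg Subtype.val hv
    · rintro ⟨s, hs⟩
      exact ⟨e s, Subtype.ext hs⟩
  let Φ : OrbitSpace K γ J ≃ₜ momentAngle K :=
    { toFun := Quotient.lift (fun z : UC K => π z) fun z w hzw =>
        ((hπact _ w.2 _ z.2).2 ((hrel z w).1 hzw)).symm
      invFun := fun x => Quotient.mk _ ⟨x, momentAngle_subset_UCset x.2⟩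
      left_inv := by
        intro q
        induction q using Quotient.inductionOn with
        | h z =>
          refine Quotient.sound ((hrel _ _).2 ⟨ν z, ?_⟩)
          exact (hπ z z.2).symm
      right_inv := fun x => hπfix x
      continuous_toFun := (continuousOn_iff_continuous_domRestrict.1 hπc).quotient_lift _
      continuous_invFun := continuous_quotient_mk'.comp
        (continuous_subtype_val.subtype_mk _) }
  -- Gale duality gives `m = dim W + 2ℓ`, and the orbits take up `ℓ` complex dimensions.
  have hrank : Module.finrank ℂ (Fin m → ℂ) =
      Module.finrank ℂ (EuclideanSpace ℂ (Fin (Module.finrank ℝ W + ℓ))) +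
        Module.finrank ℂ (Fin ℓ → ℂ) := by
    have := hgale.finrank_eq
    rw [Module.finrank_fin_fun, Module.finrank_fin_fun, finrank_euclideanSpace_fin]
    omega
  refine ⟨Φ, isCompact_iff_compactSpace.1 isCompact_momentAngle, ?_⟩
  exact exists_chartedSpace_isSubmersion hrank (act := fun s z => expMap γ J (e s) z)
    (contDiff_expMap hJ e he) (fun z => by rw [map_zero, expMap_zero]) (UC K) hU
    (fun z hz => injective_fderiv_expMap hJ e he hgale hfan hz) hνc hνact hπc hπo hπact
    fun x => ⟨x, momentAngle_subset_UCset x.2, hπfix x⟩
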